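/- Let $(E,e,T)$ be a Riesz conditional triple: $E$ is a Dedekind complete Riesz space with weak order unit $e$, and $T:E\to E$ is a conditional expectation operator, i.e. an order continuous, strictly positive linear projection with $Te=e$ whose range is a Dedekind complete Riesz subspace of $E$. Let $E^u$ be the universal completion of $E$, let $L^1(T)\subseteq E^u$ be the natural domain of $T$, that is, the set of all $f\in E^u$ for which there is an increasing net $(a_i)$ in $E_+$ with $a_i\uparrow |f|$ in $E^u$ and $(Ta_i)$ order bounded in $E^u$, and denote also by $T$ the extension of $T$ to $L^1(T)$, given by $Tf=\sup_i Ta_i$ if $0\le a_i\uparrow f$ and by $Tf=Tf^+-Tf^-$ in general. For $w\ge 0$ let $P_w$ be the projection onto the band generated by $w$. Let $\mathcal F$ be a family in $L^1(T)$ and let $\varphi:[0,\infty)\to[0,\infty)$ be a convex function with $\lim_{t\to\infty}\varphi(t)/t=\infty$. Suppose that $\varphi(|x|)\in L^1(T)$ for all $x\in\mathcal F$, where $\varphi(|x|)\in E^u$ is given by the functional calculus with respect to $e$, and that $$\sup_{x\in\mathcal F}T\varphi(|x|)$$ exists in $L^1(T)$. Then $\mathcal F$ is $T$-uniform: for every $c>0$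 the supremum $\sup_{x\in\mathcal F}T P_{(|x|-ce)^+}|x|$ exists in $L^1(T)$, and it converges to $0$ in order as $c\to\infty$. -/

import Mathlib

namespace RieszTriple

/-! Conventions. A Dedekind complete Riesz space is a real ordered vector space whose order is a
`ConditionallyCompleteLattice`. -/

section Basic

variable {V : Type*} [ConditionallyCompleteLattice V] [AddCommGroup V] [IsOrderedAddMonoid V]
  [Module ℝ V] [IsOrderedModule ℝ V]

/-- `e` is a weak order unit: `e ≥ 0` and only `0` is disjoint from `e`. -/
structure IsWeakOrderUnit (e : V) : Prop where
  nonneg : 0 ≤ e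
  eq_zero_of_disjoint : ∀ x : V, |x| ⊓ e = 0 → x = 0

/-- The projection `P_w` onto the band generated by `w ≥ 0`: for `u ≥ 0` it is
`sup_n (u ⊓ n w)` (the supremum exists, the family being bounded by `u`), and it is extended to
all `u` by `P_w u = P_w u⁺ - P_w u⁻`. -/
noncomputable def bandProj (w u : V) : V :=
  (⨆ n : ℕ, u⁺ ⊓ (n • w)) - (⨆ n : ℕ, u⁻ ⊓ (n • w))

/-- The component of `e` on which `a e ≤ x ≤ b e`, for reals `a ≤ b`:
`e - P_{(a e - x)⁺} e - P_{(x - b e)⁺} e`.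
For random variables this is the indicator of the event `{a ≤ x ≤ b}`. -/
noncomputable def slab (e x : V) (a b : ℝ) : V :=
  e - bandProj (a • e - x)⁺ e - bandProj (x - b • e)⁺ e

/-- `u = φ(x)`, where `x ≥ 0` and `φ` is a nonnegative convex function on `[0, ∞)`:
`u` is the supremum of all spectral steps `c • 1_{a ≤ x ≤ b}` that lie below `φ`, that is, with
`c ≤ φ` on `[a, b]`. As `φ` is continuous on `(0, ∞)`, and as `a = b = 0` is allowed, this is the
value at `x` of the usual spectral functional calculus of the universal completion with unit `e`;
for functions it is the composition `φ ∘ x`. -/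
def IsFunctionalValue (e : V) (φ : ℝ → ℝ) (x u : V) : Prop :=
  IsLUB {w : V | ∃ a b c : ℝ, 0 ≤ a ∧ a ≤ b ∧ (∀ t ∈ Set.Icc a b, c ≤ φ t) ∧
    w = c • slab e x a b} u

/-- `y` is the supremum of `S` in the partially ordered set `L ⊆ V`. -/
def IsSupIn (L S : Set V) (y : V) : Prop :=
  y ∈ L ∧ (∀ s ∈ S, s ≤ y) ∧ ∀ z ∈ L, (∀ s ∈ S, s ≤ z) → y ≤ z

/-- The net `(s c)`, `c → ∞`, converges to `0` in order in `L ⊆ V`: it is eventually dominated by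
each member of some net of elements of `L` that decreases to `0` in `L`. -/
def OrderNull (L : Set V) (s : ℝ → V) : Prop :=
  ∃ D : Set V, D ⊆ L ∧ D.Nonempty ∧ DirectedOn (· ≥ ·) D ∧
    (∀ d ∈ D, 0 ≤ d) ∧ (∀ z ∈ L, (∀ d ∈ D, z ≤ d) → z ≤ 0) ∧
    ∀ d ∈ D, ∀ᶠ c in Filter.atTop, |s c| ≤ d

end Basic

section Triple

variable {E : Type*} [ConditionallyCompleteLattice E] [AddCommGroup E] [IsOrderedAddMonoid E]
  [Module ℝ E] [IsOrderedModule ℝ E]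
variable {V : Type*} [ConditionallyCompleteLattice V] [AddCommGroup V] [IsOrderedAddMonoid V]
  [Module ℝ V] [IsOrderedModule ℝ V]

/-- `(E, e, T)` is a Riesz conditional triple: `e` is a weak order unit and `T` is a conditional
expectation operator, that is, an order continuous strictly positive projection with `T e = e`
whose range is a Dedekind complete Riesz subspace. -/
structure IsCondTriple (e : E) (T : E →ₗ[ℝ] E) : Prop where
  weakOrderUnit : IsWeakOrderUnit e
  nonneg : ∀ x : E, 0 ≤ x → 0 ≤ T x
  strict : ∀ x : E, 0 ≤ x → T x = 0 → x = 0
  proj : ∀ x : E, T (T x) = T x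
  unit : T e = e
  /-- Order continuity (of a positive operator): `D ↓ 0` implies `T D ↓ 0`. -/
  orderCont : ∀ D : Set E, D.Nonempty → DirectedOn (· ≥ ·) D → IsGLB D 0 → IsGLB (T '' D) 0
  range_sup : ∀ x ∈ Set.range T, ∀ y ∈ Set.range T, x ⊔ y ∈ Set.range T
  range_complete : ∀ S : Set E, S ⊆ Set.range T → S.Nonempty →
    (∃ b ∈ Set.range T, ∀ s ∈ S, s ≤ b) → ∃ y, IsSupIn (Set.range T) S y

/-- `ι : E → V` is a universal completion of `E`: `V` (Dedekind complete) is laterally complete,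
and `ι` is an injective Riesz homomorphism whose range is order dense in `V`. These properties
determine `(V, ι)` up to a unique isomorphism. -/
structure IsUniversalCompletion (ι : E →ₗ[ℝ] V) : Prop where
  injective : Function.Injective ι
  map_sup : ∀ a b : E, ι (a ⊔ b) = ι a ⊔ ι b
  orderDense : ∀ v : V, 0 < v → ∃ a : E, 0 < ι a ∧ ι a ≤ v
  /-- Every disjoint nonempty set in `V₊` has a supremum. -/
  laterallyComplete : ∀ S : Set V, S.Nonempty → (∀ s ∈ S, 0 ≤ s) → S.Pairwise (fun s t => s ⊓ t = 0) →
    ∃ y, IsLUB S y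

/-- The images `T a` of the elements `a` of `E` with `0 ≤ a ≤ u`, taken in `E^u`. These `a` form an
increasing net with supremum `u`, for every `u ≥ 0` in `E^u`. -/
def lowerImages (ι : E →ₗ[ℝ] V) (T : E →ₗ[ℝ] E) (u : V) : Set V :=
  {w : V | ∃ a : E, 0 ≤ a ∧ ι a ≤ u ∧ w = ι (T a)}

/-- The natural domain `L¹(T) ⊆ E^u` of `T`: all `f` such that `|f|` is the supremum of an
increasing net `(a_i)` in `E₊` with `(T a_i)` order bounded in `E^u`. -/
def L1 (ι : E →ₗ[ℝ] V) (T : E →ₗ[ℝ] E) : Set V :=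
  {f : V | BddAbove (lowerImages ι T |f|)}

/-- The extension of `T` to `L¹(T)`: `T f = sup_i T a_i` for `f ≥ 0` and `a_i ↑ f` in `E₊`, and
`T f = T f⁺ - T f⁻` in general. Only its values on `L1 ι T` are meaningful. -/
noncomputable def ext (ι : E →ₗ[ℝ] V) (T : E →ₗ[ℝ] E) (f : V) : V :=
  sSup (lowerImages ι T f⁺) - sSup (lowerImages ι T f⁻)

/-- The family `F` in `L¹(T)` is `T`-uniform: `sup_{x ∈ F} T P_{(|x| - c e)⁺} |x|` exists in
`L¹(T)` for `c > 0` and converges to `0` in order as `c → ∞`. -/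
def IsTUniform (ι : E →ₗ[ℝ] V) (e : E) (T : E →ₗ[ℝ] E) (F : Set V) : Prop :=
  F ⊆ L1 ι T ∧ ∃ s : ℝ → V,
    (∀ c : ℝ, 0 < c → IsSupIn (L1 ι T)
      {w : V | ∃ x ∈ F, w = ext ι T (bandProj (|x| - c • ι e)⁺ |x|)} (s c)) ∧
    OrderNull (L1 ι T) s

end Triple

end RieszTriple

set_option linter.unusedSectionVars false

/-! Let `y = sup T φ(|x|)`. Superlinear growth gives, for each `N > 0`, a threshold `t` with `N s ≤
φ(s)` for `s ≥ t`. Hence `N P_{(|x| - c e)⁺}|x| ≤ φ(|x|)` for `c ≥ t`, and applying `T` bounds the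
tail supremum by `N⁻¹ y`, uniformly in `x`; by the Archimedean property these bounds decrease to
`0`. For arbitrary `c`, the case `N = 1` yields `|x| ≤ t e + φ(|x|)`, so the tails stay below `t e +
y` and their supremum exists in the solid set `L¹(T)`. The main work is
`IsFunctionalValue.smul_bandProj_le`, which carries the scalar inequality into `E^u`. The half-line
`[c, ∞)` is cut into intervals of length `δ`; on each spectral slab a constant step of `φ` shows `N
x - u ≤ N δ e`, the slabs exhaust the band of `(x - c e)⁺`, and `δ → 0`. -/

namespace RieszTriple

/-! ### Disjointness and band projections -/

section Lattice

variable {V : Type*} [ConditionallyCompleteLattice V] [AddCommGroup V] [IsOrderedAddMonoid V]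

lemma inf_add_le_add {a b c : V} (ha : 0 ≤ a) (hb : 0 ≤ b) (hc : 0 ≤ c) :
    a ⊓ (b + c) ≤ a ⊓ b + a ⊓ c := by
  have h1 : a ⊓ (b + c) - a ⊓ c ≤ a := by
    have : 0 ≤ a ⊓ c := le_inf ha hc
    exact (sub_le_self _ this).trans inf_le_left
  have h2 : a ⊓ (b + c) - a ⊓ c ≤ b := by
    rw [sub_le_iff_le_add, add_inf]
    exact le_inf (inf_le_left.trans (le_add_of_nonneg_left hb)) inf_le_right
  exact sub_le_iff_le_add.1 (le_inf h1 h2)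

lemma disjoint_mono {a b a' b' : V} (h : a ⊓ b = 0) (ha : a' ≤ a) (hb : b' ≤ b) (ha0 : 0 ≤ a')
    (hb0 : 0 ≤ b') : a' ⊓ b' = 0 :=
  le_antisymm ((inf_le_inf ha hb).trans h.le) (le_inf ha0 hb0)

lemma disjoint_add {a b c : V} (ha : 0 ≤ a) (hb : 0 ≤ b) (hc : 0 ≤ c) (hab : a ⊓ b = 0)
    (hac : a ⊓ c = 0) : a ⊓ (b + c) = 0 := by
  refine le_antisymm ?_ (le_inf ha (add_nonneg hb hc))
  simpa [hab, hac] using inf_add_le_add ha hb hc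

lemma disjoint_nsmul {a b : V} (ha : 0 ≤ a) (hb : 0 ≤ b) (hab : a ⊓ b = 0) (n : ℕ) :
    a ⊓ (n • b) = 0 := by
  induction n with
  | zero => simpa using ha
  | succ n ih =>
    rw [succ_nsmul]
    exact disjoint_add ha (nsmul_nonneg hb n) hb ih hab

lemma add_le_of_disjoint {a b c : V} (h : a ⊓ b = 0) (ha : a ≤ c) (hb : b ≤ c) : a + b ≤ c := by
  rw [← inf_add_sup a b, h, zero_add]
  exact sup_le ha hb

/-- A Dedekind complete Riesz space is Archimedean. -/
lemma nonpos_of_nsmul_le {g x : V} (h : ∀ n : ℕ, n • g ≤ x) : g ≤ 0 := by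
  have hb : BddAbove (Set.range fun n : ℕ => n • g) := ⟨x, by rintro _ ⟨n, rfl⟩; exact h n⟩
  have h1 : (⨆ n : ℕ, n • g) ≤ (⨆ n : ℕ, n • g) - g := by
    refine ciSup_le fun n => ?_
    rw [le_sub_iff_add_le, ← succ_nsmul]
    exact le_ciSup hb (n + 1)
  simpa using h1

lemma posPart_disjoint (x y : V) : (x - y)⁺ ⊓ (y - x)⁺ = 0 := by
  have := posPart_inf_negPart_eq_zero (x - y)
  rwa [← posPart_neg, neg_sub] at this

lemma bandProj_of_nonneg {w u : V} (hu : 0 ≤ u) (hw : 0 ≤ w) :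
    bandProj w u = ⨆ n : ℕ, u ⊓ (n • w) := by
  have h : ∀ n : ℕ, (0 : V) ⊓ (n • w) = 0 := fun n => inf_eq_left.2 (nsmul_nonneg hw n)
  rw [bandProj, posPart_of_nonneg hu, negPart_of_nonneg hu]
  simp [h]

lemma inf_nsmul_le_bandProj {w u : V} (hu : 0 ≤ u) (hw : 0 ≤ w) (n : ℕ) :
    u ⊓ (n • w) ≤ bandProj w u := by
  rw [bandProj_of_nonneg hu hw]
  exact le_ciSup (f := fun n : ℕ => u ⊓ (n • w))
    ⟨u, by rintro _ ⟨n, rfl⟩; exact inf_le_left⟩ n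

lemma bandProj_le_of_forall {w u v : V} (hu : 0 ≤ u) (hw : 0 ≤ w)
    (h : ∀ n : ℕ, u ⊓ (n • w) ≤ v) : bandProj w u ≤ v := by
  rw [bandProj_of_nonneg hu hw]
  exact ciSup_le h

lemma bandProj_le_self {w u : V} (hu : 0 ≤ u) (hw : 0 ≤ w) : bandProj w u ≤ u :=
  bandProj_le_of_forall hu hw fun _ => inf_le_left

lemma bandProj_nonneg {w u : V} (hu : 0 ≤ u) (hw : 0 ≤ w) : 0 ≤ bandProj w u := by
  have := inf_nsmul_le_bandProj hu hw 0
  rwa [zero_nsmul, inf_eq_right.2 hu] at this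

lemma inf_le_bandProj {w u : V} (hu : 0 ≤ u) (hw : 0 ≤ w) : u ⊓ w ≤ bandProj w u := by
  simpa using inf_nsmul_le_bandProj hu hw 1

/-- Adding the overlap to `u ⊓ n w` stays below `u ⊓ (n + 1) w`, so the supremum absorbs the
overlap, which must vanish. -/
lemma sub_bandProj_disjoint {w u : V} (hu : 0 ≤ u) (hw : 0 ≤ w) :
    (u - bandProj w u) ⊓ w = 0 := by
  have h0 : 0 ≤ u - bandProj w u := sub_nonneg.2 (bandProj_le_self hu hw)
  refine le_antisymm ?_ (le_inf h0 hw)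
  have : bandProj w u ≤ bandProj w u - (u - bandProj w u) ⊓ w := by
    refine bandProj_le_of_forall hu hw fun n => ?_
    rw [le_sub_iff_add_le]
    refine le_trans (le_inf ?_ ?_) (inf_nsmul_le_bandProj hu hw (n + 1))
    · have := add_le_add (inf_nsmul_le_bandProj hu hw n)
        (inf_le_left : (u - bandProj w u) ⊓ w ≤ _)
      simpa using this
    · rw [succ_nsmul]
      exact add_le_add inf_le_right inf_le_right
  simpa using this

/-- The overlap is disjoint from each `u ⊓ n w`, and both lie below `P_w u`, hence so does their
sum; subtracting the overlap leaves an upper bound. -/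
lemma disjoint_bandProj {w u g : V} (hu : 0 ≤ u) (hw : 0 ≤ w) (hg : 0 ≤ g) (h : g ⊓ w = 0) :
    g ⊓ bandProj w u = 0 := by
  have hg' : 0 ≤ g ⊓ bandProj w u := le_inf hg (bandProj_nonneg hu hw)
  refine le_antisymm ?_ hg'
  have : bandProj w u ≤ bandProj w u - g ⊓ bandProj w u := by
    refine bandProj_le_of_forall hu hw fun n => ?_
    rw [le_sub_iff_add_le]
    refine add_le_of_disjoint ?_ (inf_nsmul_le_bandProj hu hw n) inf_le_right
    rw [inf_comm]
    exact disjoint_mono (disjoint_nsmul hg hw h n) inf_le_left inf_le_right hg'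
      (le_inf hu (nsmul_nonneg hw n))
  simpa using this

lemma sub_bandProj_disjoint_bandProj {w u : V} (hu : 0 ≤ u) (hw : 0 ≤ w) :
    (u - bandProj w u) ⊓ bandProj w u = 0 :=
  disjoint_bandProj hu hw (sub_nonneg.2 (bandProj_le_self hu hw)) (sub_bandProj_disjoint hu hw)

lemma bandProj_disjoint_bandProj {v w u : V} (hu : 0 ≤ u) (hv : 0 ≤ v) (hw : 0 ≤ w)
    (h : v ⊓ w = 0) : bandProj v u ⊓ bandProj w u = 0 := by
  refine disjoint_bandProj hu hw (bandProj_nonneg hu hv) ?_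
  rw [inf_comm] at h ⊢
  exact disjoint_bandProj hu hv hw h

end Lattice

/-! ### Spectral slabs and the functional calculus -/

section Spectral

variable {V : Type*} [ConditionallyCompleteLattice V] [AddCommGroup V] [IsOrderedAddMonoid V]
  [Module ℝ V] [IsOrderedModule ℝ V]

lemma disjoint_smul {a b : V} (ha : 0 ≤ a) (hb : 0 ≤ b) (hab : a ⊓ b = 0) {r : ℝ} (hr : 0 ≤ r) :
    a ⊓ (r • b) = 0 := by
  obtain ⟨n, hn⟩ := exists_nat_ge r
  refine disjoint_mono (disjoint_nsmul ha hb hab n) le_rfl ?_ ha (smul_nonneg hr hb)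
  rw [← Nat.cast_smul_eq_nsmul ℝ]
  exact smul_le_smul_of_nonneg_right hn hb

variable {e x : V}

lemma spectral_disjoint (he : 0 ≤ e) {a b : ℝ} (hab : a ≤ b) :
    bandProj (a • e - x)⁺ e ⊓ bandProj (x - b • e)⁺ e = 0 := by
  refine bandProj_disjoint_bandProj he (posPart_nonneg _) (posPart_nonneg _) ?_
  refine disjoint_mono (posPart_disjoint (a • e) x) le_rfl ?_ (posPart_nonneg _) (posPart_nonneg _)
  exact posPart_mono (sub_le_sub_left (smul_le_smul_of_nonneg_right hab he) x)

lemma slab_nonneg (he : 0 ≤ e) {a b : ℝ} (hab : a ≤ b) : 0 ≤ slab e x a b := by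
  rw [slab, sub_sub, sub_nonneg]
  exact add_le_of_disjoint (spectral_disjoint he hab) (bandProj_le_self he (posPart_nonneg _))
    (bandProj_le_self he (posPart_nonneg _))

lemma slab_disjoint_sub (he : 0 ≤ e) {a b : ℝ} (hab : a ≤ b) :
    slab e x a b ⊓ (e - slab e x a b) = 0 := by
  have hs := slab_nonneg (x := x) he hab
  have hm : 0 ≤ bandProj (a • e - x)⁺ e := bandProj_nonneg he (posPart_nonneg _)
  have hq : 0 ≤ bandProj (x - b • e)⁺ e := bandProj_nonneg he (posPart_nonneg _)
  have h : e - slab e x a b = bandProj (a • e - x)⁺ e + bandProj (x - b • e)⁺ e := by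
    rw [slab]; abel
  rw [h]
  refine disjoint_add hs hm hq ?_ ?_
  · refine disjoint_mono (sub_bandProj_disjoint_bandProj he (posPart_nonneg (a • e - x)))
      ?_ le_rfl hs hm
    exact sub_le_self _ hq
  · refine disjoint_mono (sub_bandProj_disjoint_bandProj he (posPart_nonneg (x - b • e)))
      ?_ le_rfl hs hq
    exact sub_le_sub_right (sub_le_self _ hm) _

lemma slab_disjoint_posPart (he : 0 ≤ e) {a b : ℝ} (hab : a ≤ b) :
    slab e x a b ⊓ (x - b • e)⁺ = 0 := by
  refine disjoint_mono (sub_bandProj_disjoint he (posPart_nonneg (x - b • e)))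
    ?_ le_rfl (slab_nonneg he hab) (posPart_nonneg _)
  exact sub_le_sub_right (sub_le_self _ (bandProj_nonneg he (posPart_nonneg _))) _

/-- Chebyshev's inequality for the spectral components of `x`. -/
lemma smul_bandProj_le (he : 0 ≤ e) (hx : 0 ≤ x) {t : ℝ} (ht : 0 < t) :
    t • bandProj (x - t • e)⁺ e ≤ x := by
  rw [← le_inv_smul_iff_of_pos ht]
  refine bandProj_le_of_forall he (posPart_nonneg _) fun n => ?_
  rw [le_inv_smul_iff_of_pos ht, ← sub_nonpos]
  have hw := posPart_nonneg (x - t • e)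
  -- The excess `t (e ⊓ n w) - x` lies below two disjoint elements, so it is at most `0`.
  have h0 : (t • e - x)⁺ ⊓ (t • (n • (x - t • e)⁺)) = 0 :=
    disjoint_smul (posPart_nonneg _) (nsmul_nonneg hw n)
      (disjoint_nsmul (posPart_nonneg _) hw (posPart_disjoint _ _) n) ht.le
  rw [← h0]
  refine le_inf (le_trans ?_ (le_posPart _)) ?_
  · exact sub_le_sub_right (smul_le_smul_of_nonneg_left inf_le_left ht.le) _
  · exact (sub_le_self _ hx).trans (smul_le_smul_of_nonneg_left inf_le_right ht.le)

/-- An element disjoint from all the spectral components on `[c + k δ, c + (k + 1) δ]` is disjoint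
from `(x - c e)⁺`. -/
lemma disjoint_posPart_of_disjoint_slab (he : IsWeakOrderUnit e) (hx : 0 ≤ x) {c δ : ℝ}
    (hc : 0 < c) (hδ : 0 < δ) {g : V} (hg : 0 ≤ g)
    (h : ∀ k : ℕ, g ⊓ slab e x (c + k * δ) (c + (k + 1) * δ) = 0) : g ⊓ (x - c • e)⁺ = 0 := by
  have he0 := he.nonneg
  set q : ℝ → V := fun t => bandProj (x - t • e)⁺ e with hq
  have hq0 : ∀ t, 0 ≤ q t := fun t => bandProj_nonneg he0 (posPart_nonneg _)
  set f := g ⊓ q c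
  have hf0 : 0 ≤ f := le_inf hg (hq0 c)
  have hfe : f ≤ e := inf_le_right.trans (bandProj_le_self he0 (posPart_nonneg _))
  -- Here `e` splits into the parts `x < a`, `a ≤ x ≤ b` and `x > b`; `f` misses the first by
  -- induction and the second by `h`, so it lies in the third.
  have hle : ∀ k : ℕ, f ≤ q (c + k * δ) := by
    intro k
    induction k with
    | zero =>
      rw [Nat.cast_zero, zero_mul, add_zero]
      exact inf_le_right
    | succ k ih =>
      set a := c + k * δ
      have hb : c + ((k + 1 : ℕ) : ℝ) * δ = c + ((k : ℝ) + 1) * δ := by push_cast; rfl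
      rw [hb]
      set b := c + ((k : ℝ) + 1) * δ
      have hab : a ≤ b := by simp only [a, b]; nlinarith
      have hs := slab_nonneg (x := x) he0 hab
      have hm : 0 ≤ bandProj (a • e - x)⁺ e := bandProj_nonneg he0 (posPart_nonneg _)
      have hdec : e = (slab e x a b + bandProj (a • e - x)⁺ e) + q b := by
        simp only [slab, hq]; abel
      have h1 : f ⊓ slab e x a b = 0 := disjoint_mono (h k) inf_le_left le_rfl hf0 hs
      have h2 : f ⊓ bandProj (a • e - x)⁺ e = 0 := by
        rw [inf_comm]
        exact disjoint_mono (spectral_disjoint he0 le_rfl) le_rfl ih hm hf0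
      have h3 := inf_add_le_add hf0 (add_nonneg hs hm) (hq0 b)
      rw [← hdec, disjoint_add hf0 hs hm h1 h2, zero_add, inf_eq_left.2 hfe] at h3
      exact h3.trans inf_le_right
  have hf : f = 0 := by
    refine le_antisymm ?_ hf0
    suffices hsuff : δ • f ≤ 0 by
      rw [smul_nonpos_iff_nonpos_of_pos_left hδ] at hsuff
      exact hsuff
    -- Chebyshev at the level `c + k δ` gives `k δ f ≤ x` for every `k`.
    refine nonpos_of_nsmul_le (x := x) fun k => ?_
    rw [← Nat.cast_smul_eq_nsmul ℝ, smul_smul]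
    have ht : 0 < c + k * δ := by positivity
    refine le_trans ?_ (smul_bandProj_le he0 hx ht)
    refine (smul_le_smul_of_nonneg_right (by linarith) hf0).trans
      (smul_le_smul_of_nonneg_left (hle k) ht.le)
  refine he.eq_zero_of_disjoint _ ?_
  have hw := posPart_nonneg (x - c • e)
  rw [abs_of_nonneg (le_inf hg hw), inf_assoc]
  refine disjoint_mono hf le_rfl ?_ hg (le_inf hw he0)
  rw [inf_comm]
  exact inf_le_bandProj he0 hw

lemma IsFunctionalValue.nonneg {φ : ℝ → ℝ} {u : V} (hφ : ∀ t : ℝ, 0 ≤ t → 0 ≤ φ t)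
    (hu : IsFunctionalValue e φ x u) : 0 ≤ u :=
  hu.1 ⟨0, 0, 0, le_rfl, le_rfl, fun t ht => hφ t ht.1, (zero_smul _ _).symm⟩

/-- If `N t ≤ φ(t)` for `t ≥ c`, then `N x ≤ φ(x)` on the band where `x > c e`. -/
lemma IsFunctionalValue.smul_bandProj_le {φ : ℝ → ℝ} {u : V} (he : IsWeakOrderUnit e)
    (hx : 0 ≤ x) (hφ : ∀ t : ℝ, 0 ≤ t → 0 ≤ φ t) (hu : IsFunctionalValue e φ x u) {c N : ℝ}
    (hc : 0 < c) (hN : 0 < N) (h : ∀ t, c ≤ t → N * t ≤ φ t) :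
    N • bandProj (x - c • e)⁺ x ≤ u := by
  have he0 := he.nonneg
  have hu0 := hu.nonneg hφ
  set w := (x - c • e)⁺ with hwdef
  have hw : 0 ≤ w := posPart_nonneg _
  have key : ∀ δ : ℝ, 0 < δ → (N • x - u - (N * δ) • e)⁺ ⊓ w = 0 := by
    intro δ hδ
    refine disjoint_posPart_of_disjoint_slab he hx hc hδ (posPart_nonneg _) fun k => ?_
    set a := c + k * δ with ha
    have hb : c + ((k : ℝ) + 1) * δ = a + δ := by rw [ha]; ring
    rw [hb]
    have hab : a ≤ a + δ := by linarith
    have hca : c ≤ a := by rw [ha]; have : 0 ≤ k * δ := by positivity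
                           linarith
    have hs := slab_nonneg (x := x) he0 hab
    have hes : 0 ≤ e - slab e x a (a + δ) := by
      rw [slab, sub_sub, sub_sub_cancel]
      exact add_nonneg (bandProj_nonneg he0 (posPart_nonneg _))
        (bandProj_nonneg he0 (posPart_nonneg _))
    have hNa : 0 ≤ N * a := mul_nonneg hN.le (hc.le.trans hca)
    have hsu : (N * a) • slab e x a (a + δ) ≤ u := by
      refine hu.1 ⟨a, a + δ, N * a, hc.le.trans hca, hab, fun t ht => ?_, rfl⟩
      exact (mul_le_mul_of_nonneg_left ht.1 hN.le).trans (h t (hca.trans ht.1))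
    have hp := posPart_nonneg (x - (a + δ) • e)
    -- The bound is a sum of two terms, each disjoint from the slab: one lives where `x > a + δ`,
    -- the other off the slab.
    have hle : (N • x - u - (N * δ) • e)⁺ ≤
        N • (x - (a + δ) • e)⁺ + (N * a) • (e - slab e x a (a + δ)) := by
      refine sup_le ?_ (add_nonneg (smul_nonneg hN.le hp) (smul_nonneg hNa hes))
      have h1 : N • (x - (a + δ) • e) ≤ N • (x - (a + δ) • e)⁺ :=
        smul_le_smul_of_nonneg_left (le_posPart _) hN.le
      calc N • x - u - (N * δ) • e
          ≤ N • x - (N * a) • slab e x a (a + δ) - (N * δ) • e :=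
            sub_le_sub_right (sub_le_sub_left hsu _) _
        _ = N • (x - (a + δ) • e) + (N * a) • (e - slab e x a (a + δ)) := by module
        _ ≤ _ := add_le_add_left h1 _
    rw [inf_comm]
    refine disjoint_mono (disjoint_add hs (smul_nonneg hN.le hp) (smul_nonneg hNa hes) ?_ ?_)
      le_rfl hle hs (posPart_nonneg _)
    · exact disjoint_smul hs hp (slab_disjoint_posPart he0 hab) hN.le
    · exact disjoint_smul hs hes (slab_disjoint_sub he0 hab) hNa
  rw [← le_inv_smul_iff_of_pos hN]
  refine bandProj_le_of_forall hx hw fun n => ?_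
  rw [le_inv_smul_iff_of_pos hN, ← sub_nonpos]
  -- Taking `δ = 1/k` in `key` leaves an error `(N/k) e`, removed by the Archimedean property.
  refine nonpos_of_nsmul_le (x := N • e) fun k => ?_
  rcases Nat.eq_zero_or_pos k with rfl | hk
  · simpa using smul_nonneg hN.le he0
  have hk' : (0 : ℝ) < k := Nat.cast_pos.2 hk
  rw [← Nat.cast_smul_eq_nsmul ℝ, ← le_inv_smul_iff_of_pos hk', smul_smul, mul_comm, ← sub_nonpos]
  have h0 := disjoint_smul (posPart_nonneg _) (nsmul_nonneg hw n)
    (disjoint_nsmul (posPart_nonneg _) hw (key (k : ℝ)⁻¹ (inv_pos.2 hk')) n) hN.le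
  rw [← h0]
  have hNk : 0 ≤ (N * (k : ℝ)⁻¹) • e := smul_nonneg (by positivity) he0
  refine le_inf (le_trans ?_ (le_posPart _)) ?_
  · exact sub_le_sub_right (sub_le_sub_right (smul_le_smul_of_nonneg_left inf_le_left hN.le) _) _
  · exact (sub_le_self _ hNk).trans ((sub_le_self _ hu0).trans
      (smul_le_smul_of_nonneg_left inf_le_right hN.le))

lemma sub_le_bandProj (he : 0 ≤ e) (hx : 0 ≤ x) {t : ℝ} (ht : 0 ≤ t) :
    x - t • e ≤ bandProj (x - t • e)⁺ x := by
  refine le_trans (le_inf ?_ (le_posPart _)) (inf_le_bandProj hx (posPart_nonneg _))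
  exact sub_le_self _ (smul_nonneg ht he)

end Spectral

/-! ### The universal completion and the extension of `T` -/

section Triple

variable {E : Type*} [ConditionallyCompleteLattice E] [AddCommGroup E] [IsOrderedAddMonoid E]
  [Module ℝ E] [IsOrderedModule ℝ E]
variable {V : Type*} [ConditionallyCompleteLattice V] [AddCommGroup V] [IsOrderedAddMonoid V]
  [Module ℝ V] [IsOrderedModule ℝ V]
variable {ι : E →ₗ[ℝ] V} {T : E →ₗ[ℝ] E} {e : E}

namespace IsUniversalCompletion

lemma mono (hι : IsUniversalCompletion ι) : Monotone ι := by
  intro a b h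
  rw [← sup_eq_right, ← hι.map_sup, sup_eq_right.2 h]

lemma le_of_map_le (hι : IsUniversalCompletion ι) {a b : E} (h : ι a ≤ ι b) : a ≤ b := by
  rw [← sup_eq_right] at h ⊢
  rw [← hι.map_sup] at h
  exact hι.injective h

lemma map_inf (hι : IsUniversalCompletion ι) (a b : E) : ι (a ⊓ b) = ι a ⊓ ι b := by
  have h := hι.map_sup (-a) (-b)
  rwa [← neg_inf, map_neg, map_neg, map_neg, ← neg_inf, neg_inj] at h

/-- By order density, a nonzero element disjoint from `ι e` would dominate a nonzero `ι a` with `a`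
disjoint from `e`. -/
lemma isWeakOrderUnit (hι : IsUniversalCompletion ι) (he : IsWeakOrderUnit e) :
    IsWeakOrderUnit (ι e) := by
  refine ⟨by simpa using hι.mono he.nonneg, fun v hv => ?_⟩
  by_contra hne
  have hv0 : |v| ≠ 0 := fun h =>
    hne (le_antisymm ((le_abs_self v).trans h.le) (neg_nonpos.1 ((neg_le_abs v).trans h.le)))
  obtain ⟨a, ha, hav⟩ := hι.orderDense |v| ((abs_nonneg v).lt_of_ne hv0.symm)
  have ha0 : 0 ≤ a := hι.le_of_map_le (by simpa using ha.le)
  have h : a ⊓ e = 0 := by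
    apply hι.injective
    rw [hι.map_inf, map_zero]
    exact disjoint_mono hv hav le_rfl ha.le (by simpa using hι.mono he.nonneg)
  have := he.eq_zero_of_disjoint a (by rwa [abs_of_nonneg ha0])
  simp [this] at ha

end IsUniversalCompletion

lemma lowerImages_mono {u v : V} (h : u ≤ v) : lowerImages ι T u ⊆ lowerImages ι T v := by
  rintro _ ⟨a, ha, hau, rfl⟩
  exact ⟨a, ha, hau.trans h, rfl⟩

lemma zero_mem_lowerImages {u : V} (hu : 0 ≤ u) : (0 : V) ∈ lowerImages ι T u :=
  ⟨0, le_rfl, by simpa using hu, by simp⟩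

lemma mem_L1_of_le {f g : V} (hg : g ∈ L1 ι T) (h : |f| ≤ |g|) : f ∈ L1 ι T :=
  BddAbove.mono (lowerImages_mono h) hg

lemma ext_of_nonneg (hι : IsUniversalCompletion ι) {f : V} (hf : 0 ≤ f) :
    ext ι T f = sSup (lowerImages ι T f) := by
  have h0 : lowerImages ι T (0 : V) = {0} := by
    refine Set.eq_singleton_iff_unique_mem.2 ⟨zero_mem_lowerImages le_rfl, ?_⟩
    rintro _ ⟨a, ha, hau, rfl⟩
    have : a = 0 := le_antisymm (hι.le_of_map_le (by simpa using hau)) ha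
    simp [this]
  rw [ext, posPart_of_nonneg hf, negPart_of_nonneg hf, h0, csSup_singleton, sub_zero]

lemma le_ext {f w : V} (hι : IsUniversalCompletion ι) (hf : 0 ≤ f) (hfL : f ∈ L1 ι T)
    (hw : w ∈ lowerImages ι T f) : w ≤ ext ι T f := by
  rw [ext_of_nonneg hι hf]
  refine le_csSup ?_ hw
  have h : BddAbove (lowerImages ι T |f|) := hfL
  rwa [abs_of_nonneg hf] at h

lemma ext_le {f z : V} (hι : IsUniversalCompletion ι) (hf : 0 ≤ f)
    (h : ∀ w ∈ lowerImages ι T f, w ≤ z) : ext ι T f ≤ z := by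
  rw [ext_of_nonneg hι hf]
  exact csSup_le ⟨0, zero_mem_lowerImages hf⟩ h

lemma ext_nonneg (hι : IsUniversalCompletion ι) {f : V} (hf : 0 ≤ f) (hfL : f ∈ L1 ι T) :
    0 ≤ ext ι T f :=
  le_ext hι hf hfL (zero_mem_lowerImages hf)

lemma smul_ext_le (hι : IsUniversalCompletion ι) {f u : V} (hf : 0 ≤ f) (hu : u ∈ L1 ι T)
    {N : ℝ} (hN : 0 < N) (h : N • f ≤ u) : N • ext ι T f ≤ ext ι T u := by
  have hu0 : 0 ≤ u := (smul_nonneg hN.le hf).trans h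
  rw [← le_inv_smul_iff_of_pos hN]
  refine ext_le hι hf ?_
  rintro _ ⟨a, ha, haf, rfl⟩
  rw [le_inv_smul_iff_of_pos hN]
  refine le_ext hι hu0 hu ⟨N • a, smul_nonneg hN.le ha, ?_, by simp⟩
  rw [map_smul]
  exact (smul_le_smul_of_nonneg_left haf hN.le).trans h

/-- Split `a ≤ t e + (a - t e)⁺`: the last term is a minorant of `u`, and `T e = e`. This replaces
additivity of the extension. -/
lemma lowerImages_add_unit_le (hT : IsCondTriple e T) (hι : IsUniversalCompletion ι) {u z : V}
    {t : ℝ} (hu : 0 ≤ u) (hz : z ∈ upperBounds (lowerImages ι T u)) :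
    t • ι e + z ∈ upperBounds (lowerImages ι T (t • ι e + u)) := by
  rintro _ ⟨a, -, hau, rfl⟩
  have h1 : ι (T (a - t • e)⁺) ≤ z := by
    refine hz ⟨(a - t • e)⁺, posPart_nonneg _, ?_, rfl⟩
    rw [posPart_def, hι.map_sup, map_zero, map_sub, map_smul]
    exact sup_le (sub_le_iff_le_add'.2 hau) hu
  have h2 : T a ≤ t • e + T (a - t • e)⁺ := by
    have := hT.nonneg _ (sub_nonneg.2 (le_posPart (a - t • e)))
    rw [map_sub, map_sub, map_smul, hT.unit, sub_nonneg, sub_le_iff_le_add'] at this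
    exact this
  have h3 := hι.mono h2
  rw [map_add, map_smul] at h3
  exact h3.trans (add_le_add_right h1 _)

lemma add_unit_mem_L1 (hT : IsCondTriple e T) (hι : IsUniversalCompletion ι) {u : V} {t : ℝ}
    (ht : 0 ≤ t) (hu : 0 ≤ u) (huL : u ∈ L1 ι T) : t • ι e + u ∈ L1 ι T := by
  have h : BddAbove (lowerImages ι T |u|) := huL
  rw [abs_of_nonneg hu] at h
  obtain ⟨z, hz⟩ := h
  have he := (hι.isWeakOrderUnit hT.weakOrderUnit).nonneg
  change BddAbove (lowerImages ι T |t • ι e + u|)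
  rw [abs_of_nonneg (add_nonneg (smul_nonneg ht he) hu)]
  exact ⟨_, lowerImages_add_unit_le hT hι hu hz⟩

lemma ext_le_add_unit (hT : IsCondTriple e T) (hι : IsUniversalCompletion ι) {f u : V} {t : ℝ}
    (hf : 0 ≤ f) (hu : 0 ≤ u) (huL : u ∈ L1 ι T) (h : f ≤ t • ι e + u) :
    ext ι T f ≤ t • ι e + ext ι T u := by
  refine ext_le hι hf fun w hw => ?_
  exact lowerImages_add_unit_le hT hι hu (fun _ hv => le_ext hι hu huL hv) (lowerImages_mono h hw)

/-- The dominating net is `y / (n + 1)`; the shift keeps `n = 0` meaningful. -/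
lemma orderNull_of_eventually_smul_le {L : Set V} (hL : ∀ f g : V, g ∈ L → |f| ≤ |g| → f ∈ L)
    {y : V} (hy : y ∈ L) (hy0 : 0 ≤ y) {s : ℝ → V}
    (h : ∀ N : ℝ, 0 < N → ∀ᶠ c in Filter.atTop, N • |s c| ≤ y) : OrderNull L s := by
  have hpos : ∀ n : ℕ, (0 : ℝ) < n + 1 := fun n => by positivity
  have h0 : ∀ n : ℕ, 0 ≤ ((n : ℝ) + 1)⁻¹ • y := fun n => smul_nonneg (inv_pos.2 (hpos n)).le hy0
  have hanti : ∀ m n : ℕ, m ≤ n → ((n : ℝ) + 1)⁻¹ • y ≤ ((m : ℝ) + 1)⁻¹ • y := by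
    intro m n hmn
    have : (m : ℝ) ≤ n := Nat.cast_le.2 hmn
    exact smul_le_smul_of_nonneg_right (inv_anti₀ (hpos m) (by linarith)) hy0
  refine ⟨Set.range fun n : ℕ => ((n : ℝ) + 1)⁻¹ • y, ?_, Set.range_nonempty _, ?_, ?_, ?_, ?_⟩
  · rintro _ ⟨n, rfl⟩
    refine hL _ y hy ?_
    rw [abs_of_nonneg hy0, abs_of_nonneg (h0 n)]
    simpa using hanti 0 n n.zero_le
  · rintro _ ⟨m, rfl⟩ _ ⟨n, rfl⟩
    exact ⟨_, ⟨max m n, rfl⟩, hanti _ _ (le_max_left _ _), hanti _ _ (le_max_right _ _)⟩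
  · rintro _ ⟨n, rfl⟩
    exact h0 n
  · intro z _ hz
    refine nonpos_of_nsmul_le (x := y) fun n => ?_
    rcases n with _ | n
    · simpa using hy0
    · have := hz _ ⟨n, rfl⟩
      rw [le_inv_smul_iff_of_pos (hpos n)] at this
      rw [← Nat.cast_smul_eq_nsmul ℝ]
      exact_mod_cast this
  · rintro _ ⟨n, rfl⟩
    filter_upwards [h _ (hpos n)] with c hc
    rwa [le_inv_smul_iff_of_pos (hpos n)]

lemma exists_mul_le_of_tendsto {φ : ℝ → ℝ}
    (hφ : Filter.Tendsto (fun t => φ t / t) Filter.atTop Filter.atTop) (N : ℝ) :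
    ∃ t₀ : ℝ, 0 < t₀ ∧ ∀ t, t₀ ≤ t → N * t ≤ φ t := by
  obtain ⟨t₀, ht₀⟩ := Filter.eventually_atTop.1 (hφ.eventually_ge_atTop N)
  refine ⟨max t₀ 1, by positivity, fun t ht => ?_⟩
  have ht0 : 0 < t := lt_of_lt_of_le one_pos ((le_max_right _ _).trans ht)
  exact (le_div_iff₀ ht0).1 (ht₀ t ((le_max_left _ _).trans ht))

end Triple

end RieszTriple

/-- De la Vallée Poussin's criterion, sufficiency, for a Riesz conditional triple `(E, e, T)` with
universal completion `V = E^u` and natural domain `L¹(T) = L1 ι T`. -/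
theorem mainTheorem4
    {E : Type*} [ConditionallyCompleteLattice E] [AddCommGroup E] [IsOrderedAddMonoid E]
    [Module ℝ E] [IsOrderedModule ℝ E]
    {V : Type*} [ConditionallyCompleteLattice V] [AddCommGroup V] [IsOrderedAddMonoid V]
    [Module ℝ V] [IsOrderedModule ℝ V]
    (e : E) (T : E →ₗ[ℝ] E) (hT : RieszTriple.IsCondTriple e T)
    (ι : E →ₗ[ℝ] V) (hι : RieszTriple.IsUniversalCompletion ι)
    (F : Set V) (hF : F ⊆ RieszTriple.L1 ι T)
    (φ : ℝ → ℝ) (hφ_nonneg : ∀ t : ℝ, 0 ≤ t → 0 ≤ φ t)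
    (hφ_convex : ConvexOn ℝ (Set.Ici 0) φ)
    (hφ_lim : Filter.Tendsto (fun t => φ t / t) Filter.atTop Filter.atTop)
    (hφ_mem : ∀ x ∈ F, ∃ u ∈ RieszTriple.L1 ι T,
      RieszTriple.IsFunctionalValue (ι e) φ |x| u)
    (hsup : ∃ y : V, RieszTriple.IsSupIn (RieszTriple.L1 ι T)
      {w : V | ∃ x ∈ F, ∃ u : V, RieszTriple.IsFunctionalValue (ι e) φ |x| u ∧
        w = RieszTriple.ext ι T u} y) :
    RieszTriple.IsTUniform ι e T F := by
  have he := hι.isWeakOrderUnit hT.weakOrderUnit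
  have hsolid : ∀ f g : V, g ∈ RieszTriple.L1 ι T → |f| ≤ |g| → f ∈ RieszTriple.L1 ι T :=
    fun _ _ => RieszTriple.mem_L1_of_le
  obtain ⟨y, hyL, hy, hymin⟩ := hsup
  refine ⟨hF, ?_⟩
  rcases F.eq_empty_or_nonempty with rfl | ⟨x₀, hx₀⟩
  · -- A least element of `L¹(T)` exists only if everything is zero.
    have hmin : ∀ z ∈ RieszTriple.L1 ι T, y ≤ z := fun z hz => hymin z hz (by simp)
    have h0L : (0 : V) ∈ RieszTriple.L1 ι T := hsolid _ _ hyL (by simp)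
    -- Since `-n e` lies in `L¹(T)`, minimality gives `n e ≤ -y` for every `n`.
    have he0 : ι e = 0 := by
      refine le_antisymm (RieszTriple.nonpos_of_nsmul_le (x := -y) fun (n : ℕ) => ?_) he.nonneg
      have h := RieszTriple.add_unit_mem_L1 hT hι (Nat.cast_nonneg (α := ℝ) n) le_rfl h0L
      rw [add_zero, Nat.cast_smul_eq_nsmul ℝ] at h
      exact le_neg_of_le_neg (hmin _ (hsolid _ _ h (by rw [abs_neg])))
    have hV : ∀ v : V, v = 0 := fun v =>
      he.eq_zero_of_disjoint v (by rw [he0]; exact inf_eq_right.2 (abs_nonneg v))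
    refine ⟨fun _ => y, fun c _ => ⟨hyL, by simp, fun z hz _ => hmin z hz⟩, ?_⟩
    refine RieszTriple.orderNull_of_eventually_smul_le hsolid hyL (hV y).ge fun N _ => ?_
    exact Filter.Eventually.of_forall fun _ => ((hV _).trans (hV y).symm).le
  have hφ : ∀ x ∈ F, ∃ u ∈ RieszTriple.L1 ι T, 0 ≤ u ∧ RieszTriple.ext ι T u ≤ y ∧
      RieszTriple.IsFunctionalValue (ι e) φ |x| u := by
    intro x hx
    obtain ⟨u, huL, hu⟩ := hφ_mem x hx
    exact ⟨u, huL, hu.nonneg hφ_nonneg, hy _ ⟨x, hx, u, hu, rfl⟩, hu⟩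
  have hy0 : 0 ≤ y := by
    obtain ⟨u, huL, hu0, huy, -⟩ := hφ x₀ hx₀
    exact (RieszTriple.ext_nonneg hι hu0 huL).trans huy
  set S : ℝ → Set V := fun c =>
    {w : V | ∃ x ∈ F, w = RieszTriple.ext ι T (RieszTriple.bandProj (|x| - c • ι e)⁺ |x|)}
  have hSne : ∀ c, (S c).Nonempty := fun c => ⟨_, x₀, hx₀, rfl⟩
  have hp0 : ∀ (c : ℝ) (x : V), 0 ≤ RieszTriple.bandProj (|x| - c • ι e)⁺ |x| := fun c x =>
    RieszTriple.bandProj_nonneg (abs_nonneg x) (posPart_nonneg _)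
  have hpx : ∀ (c : ℝ) (x : V), RieszTriple.bandProj (|x| - c • ι e)⁺ |x| ≤ |x| := fun c x =>
    RieszTriple.bandProj_le_self (abs_nonneg x) (posPart_nonneg _)
  have hSpos : ∀ c, ∀ w ∈ S c, 0 ≤ w := by
    rintro c _ ⟨x, hx, rfl⟩
    refine RieszTriple.ext_nonneg hι (hp0 c x) (hsolid _ x (hF hx) ?_)
    rw [abs_of_nonneg (hp0 c x)]
    exact hpx c x
  -- One threshold serves all `c`, including small `c` where the tail estimate fails.
  obtain ⟨t, ht, hφt⟩ := RieszTriple.exists_mul_le_of_tendsto hφ_lim 1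
  have hte : 0 ≤ t • ι e := smul_nonneg ht.le he.nonneg
  have hbound : ∀ c, ∀ w ∈ S c, w ≤ t • ι e + y := by
    rintro c _ ⟨x, hx, rfl⟩
    obtain ⟨u, huL, hu0, huy, hu⟩ := hφ x hx
    have h1 := hu.smul_bandProj_le he (abs_nonneg x) hφ_nonneg ht one_pos hφt
    rw [one_smul] at h1
    have h2 := (RieszTriple.sub_le_bandProj he.nonneg (abs_nonneg x) ht.le).trans h1
    refine (RieszTriple.ext_le_add_unit hT hι (hp0 c x) hu0 huL
      ((hpx c x).trans (sub_le_iff_le_add'.1 h2))).trans ?_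
    exact add_le_add_right huy _
  have hSbdd : ∀ c, BddAbove (S c) := fun c => ⟨_, hbound c⟩
  have hs0 : ∀ c, 0 ≤ sSup (S c) := fun c => by
    obtain ⟨w, hw⟩ := hSne c
    exact (hSpos c w hw).trans (le_csSup (hSbdd c) hw)
  refine ⟨fun c => sSup (S c), fun c _ => ⟨?_, fun w hw => le_csSup (hSbdd c) hw,
    fun z _ hz => csSup_le (hSne c) hz⟩, ?_⟩
  · refine hsolid _ _ (RieszTriple.add_unit_mem_L1 hT hι ht.le hy0 hyL) ?_
    rw [abs_of_nonneg (hs0 c), abs_of_nonneg (add_nonneg hte hy0)]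
    exact csSup_le (hSne c) (hbound c)
  · refine RieszTriple.orderNull_of_eventually_smul_le hsolid hyL hy0 fun N hN => ?_
    obtain ⟨t, ht, hφt⟩ := RieszTriple.exists_mul_le_of_tendsto hφ_lim N
    filter_upwards [Filter.eventually_ge_atTop t] with c hc
    rw [abs_of_nonneg (hs0 c), ← le_inv_smul_iff_of_pos hN]
    refine csSup_le (hSne c) ?_
    rintro _ ⟨x, hx, rfl⟩
    obtain ⟨u, huL, hu0, huy, hu⟩ := hφ x hx
    rw [le_inv_smul_iff_of_pos hN]
    refine (RieszTriple.smul_ext_le hι (hp0 c x) huL hN ?_).trans huy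
    exact hu.smul_bandProj_le he (abs_nonneg x) hφ_nonneg (ht.trans_le hc) hN
      fun s hs => hφt s (hc.trans hs)
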